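/- Let $\mathcal A=\{H_1,\dots,H_l\}$ be an arrangement of pairwise distinct hyperplanes in $\mathbb{CP}^n$, ordered by their indices and defined by linear forms $\alpha_1,\dots,\alpha_l$. Its Orlik–Solomon algebra is $A=E/K$, where $E$ is the exterior algebra over $\mathbb C$ on generators $x_1,\dots,x_l$ and $K$ is the two-sided ideal generated by the elements $\sum_{j=1}^m(-1)^j x_{i_1}\wedge\cdots\wedge\widehat{x_{i_j}}\wedge\cdots\wedge x_{i_m}$ for all distinct $i_1,\dots,i_m$ with $\alpha_{i_1},\dots,\alpha_{i_m}$ linearly dependent, and by the monomials $x_{i_1}\wedge\cdots\wedge x_{i_m}$ with $H_{i_1}\cap\cdots\cap H_{i_m}=\emptyset$. A monomial $x_{i_1}\wedge\cdots\wedge x_{i_k}$ is called an NBC monomial (an element of the non broken circuit basis of $A$) if $k\le n$, $i_1<\cdots<i_k$, the forms $\alpha_{i_1},\dots,\alpha_{i_k}$ are linearly independent, and for each $j$ the hyperplane $H_{i_j}$ is the first one that contains $H_{i_j}\cap\cdots\cap H_{i_k}$. A flag $F=(S_n\supsetneq\cdots\supsetneq S_1)$ consists of nonempty intersections of hyperplanes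 of $\mathcal A$; put $j_{F,k}=\min\{j\mid S_k\subseteq H_j\}$. The flag is descendent if $j_{F,1}<\cdots<j_{F,n}$. Let $L=(H_{i_1},\dots,H_{i_n})$ be a tuple of hyperplanes with linearly independent forms. The flag $F$ is well fitted with respect to $L$ if there is a permutation $\sigma$ of $\{1,\dots,n\}$ with $S_k=\bigcap_{j=k}^n H_{i_{\sigma(j)}}$ for every $k$; this $\sigma$ is then unique, and $\mathrm{sig}_L(F)$ denotes its signature. Let $\mathrm{Desc}(L)$ be the finite set of descendent flags that are well fitted with respect to $L$. Then in $A$ $$x_{i_1}\wedge\cdots\wedge x_{i_n}=\sum_{F\in \mathrm{Desc}(L)}\mathrm{sig}_L(F)\,x_{j_{F,1}}\wedge\cdots\wedge x_{j_{F,n}},$$ and this is an expression in terms of the NBC basis: for each $F\in\mathrm{Desc}(L)$ the monomial $x_{j_{F,1}}\wedge\cdots\wedge x_{j_{F,n}}$ is an NBC monomial, and different flags in $\mathrm{Desc}(L)$ have different tuples $(j_{F,1},\dots,j_{F,n})$. -/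

import Mathlib

/-- A finite arrangement of `l` pairwise distinct hyperplanes in the complex projective space
`ℂℙⁿ`, ordered by their indices `0, …, l - 1`; the `i`-th hyperplane is the zero locus of the
nonzero linear form `form i` in the `n + 1` homogeneous coordinates. -/
structure HyperplaneArrangement (n l : ℕ) where
  form : Fin l → Module.Dual ℂ (Fin (n + 1) → ℂ)
  form_ne_zero : ∀ i, form i ≠ 0
  ker_injective : Function.Injective fun i => LinearMap.ker (form i)

namespace HyperplaneArrangement

variable {n l : ℕ} (A : HyperplaneArrangement n l)

/-- The `i`-th projective hyperplane, as a set of points of `ℂℙⁿ`. -/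
def H (i : Fin l) : Set (Projectivization ℂ (Fin (n + 1) → ℂ)) :=
  {p | p.submodule ≤ LinearMap.ker (A.form i)}

/-! ### The Orlik-Solomon algebra -/

/-- The monomial `x_{i_1} ∧ ⋯ ∧ x_{i_m}` in the exterior algebra `E` of `ℂ^l`. -/
noncomputable def extMonomial (l : ℕ) {m : ℕ} (i : Fin m → Fin l) :
    ExteriorAlgebra ℂ (Fin l → ℂ) :=
  ExteriorAlgebra.ιMulti ℂ m fun k => (Pi.single (i k) 1 : Fin l → ℂ)

/-- The element `∂ (x_{i_1} ∧ ⋯ ∧ x_{i_m}) = ∑ j, (-1)^j x_{i_1} ∧ ⋯ (omit x_{i_j}) ⋯ ∧ x_{i_m}`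
of `E`. Here `m` is the `m + 1` of the code, and the position `j` is counted from `0` in the code,
so that the sign is `(-1)^(j + 1)`. -/
noncomputable def extBoundary (l : ℕ) {m : ℕ} (i : Fin (m + 1) → Fin l) :
    ExteriorAlgebra ℂ (Fin l → ℂ) :=
  ∑ j : Fin (m + 1), (-1 : ℤ) ^ ((j : ℕ) + 1) • extMonomial l fun k => i (j.succAbove k)

/-- The generators of the Orlik-Solomon ideal: the boundaries of the monomials whose hyperplanes
intersect non generically (that is, their linear forms are dependent), and the monomials whose
hyperplanes have empty intersection in `ℂℙⁿ`. -/
inductive IsOSRelation : ExteriorAlgebra ℂ (Fin l → ℂ) → Prop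
  | boundary {m : ℕ} (i : Fin (m + 1) → Fin l) (hi : Function.Injective i)
      (hdep : ¬ LinearIndependent ℂ fun k => A.form (i k)) : IsOSRelation (extBoundary l i)
  | empty {m : ℕ} (i : Fin m → Fin l) (hempty : ⋂ k, A.H (i k) = ∅) :
      IsOSRelation (extMonomial l i)

/-- The two-sided ideal `K` of `E`. -/
def osIdeal : TwoSidedIdeal (ExteriorAlgebra ℂ (Fin l → ℂ)) :=
  TwoSidedIdeal.span {a | A.IsOSRelation a}

/-- The Orlik-Solomon algebra `E / K`. -/
abbrev OSAlgebra : Type := A.osIdeal.ringCon.Quotient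

/-- The monomial `x_{i_1} ∧ ⋯ ∧ x_{i_m}` in the Orlik-Solomon algebra. -/
noncomputable def monomial {m : ℕ} (i : Fin m → Fin l) : A.OSAlgebra :=
  A.osIdeal.ringCon.mk' (extMonomial l i)

/-- The tuple `i_1, …, i_k` indexes an element `x_{i_1} ∧ ⋯ ∧ x_{i_k}` of the non broken circuit
basis: `k ≤ n`, the tuple is increasing, its linear forms are independent, and for each `j` the
hyperplane `H_{i_j}` is the first one that contains `H_{i_j} ∩ ⋯ ∩ H_{i_k}`. -/
structure IsNBC {k : ℕ} (i : Fin k → Fin l) : Prop where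
  le : k ≤ n
  strictMono : StrictMono i
  linearIndependent : LinearIndependent ℂ fun j => A.form (i j)
  first : ∀ (j : Fin k) (a : Fin l), (⋂ m, ⋂ _ : j ≤ m, A.H (i m)) ⊆ A.H a → i j ≤ a

/-! ### Flags -/

/-- A flag `S_n ⊃ ⋯ ⊃ S_1` of nonempty projective subspaces, each of them an intersection of some
hyperplanes of the arrangement. The subspace `S_k` is `S (k - 1)` in the code. -/
@[ext]
structure Flag where
  S : Fin n → Set (Projectivization ℂ (Fin (n + 1) → ℂ))
  exists_eq : ∀ k, ∃ I : Finset (Fin l), I.Nonempty ∧ S k = ⋂ i ∈ I, A.H i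
  nonempty : ∀ k, (S k).Nonempty
  strictMono : StrictMono S

instance : Finite A.Flag := by
  choose I hI using fun (F : A.Flag) => F.exists_eq
  refine Finite.of_injective I fun F G h => Flag.ext (funext fun k => ?_)
  rw [(hI F k).2, (hI G k).2, h]

noncomputable instance : Fintype A.Flag := Fintype.ofFinite _

namespace Flag

variable {A} (F : A.Flag)

open Classical in
theorem index_nonempty (k : Fin n) :
    (Finset.univ.filter fun j : Fin l => F.S k ⊆ A.H j).Nonempty := by
  obtain ⟨I, ⟨i, hi⟩, hS⟩ := F.exists_eq k
  refine ⟨i, Finset.mem_filter.2 ⟨Finset.mem_univ i, ?_⟩⟩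
  rw [hS]
  exact Set.biInter_subset_of_mem hi

open Classical in
/-- The index `j_{F,k} = min {j | S_k ⊆ H_j}`. -/
noncomputable def index (k : Fin n) : Fin l :=
  (Finset.univ.filter fun j : Fin l => F.S k ⊆ A.H j).min' (F.index_nonempty k)

/-- The flag is descendent: `j_{F,1} < j_{F,2} < ⋯ < j_{F,n}`. -/
def IsDescendent : Prop := StrictMono F.index

/-- The flag is well fitted with respect to the tuple `L = (H_{i_1}, …, H_{i_n})` through the
permutation `σ`: `S_k = ⋂_{j ≥ k} H_{i_{σ(j)}}` for each `k`. -/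
def IsWellFittedVia (i : Fin n → Fin l) (σ : Equiv.Perm (Fin n)) : Prop :=
  ∀ k, F.S k = ⋂ j, ⋂ _ : k ≤ j, A.H (i (σ j))

/-- The flag is well fitted with respect to the tuple `L = (H_{i_1}, …, H_{i_n})`. -/
def IsWellFitted (i : Fin n → Fin l) : Prop := ∃ σ, F.IsWellFittedVia i σ

open Classical in
/-- The relative signature `sig_L(F)`: the signature of the permutation through which `F` is well
fitted with respect to `L`. That permutation is unique when `L` is linearly independent, see
`relSign_eq`. (The value is `0` if `F` is not well fitted.) -/
noncomputable def relSign (i : Fin n → Fin l) : ℤ :=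
  if h : F.IsWellFitted i then (Equiv.Perm.sign h.choose : ℤ) else 0

theorem mem_of_iInter_subset {A : HyperplaneArrangement n l} {i : Fin n → Fin l}
    (hi : LinearIndependent ℂ fun k => A.form (i k)) {P : Set (Fin n)} {a : Fin n}
    (h : (⋂ j ∈ P, A.H (i j)) ⊆ A.H (i a)) : a ∈ P := by
  have hker : (⨅ j : P, LinearMap.ker (A.form (i j))) ≤ LinearMap.ker (A.form (i a)) := by
    intro v hv
    by_cases hv0 : v = 0
    · simp [hv0]
    have hp : Projectivization.mk ℂ v hv0 ∈ ⋂ j ∈ P, A.H (i j) := by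
      simp only [Set.mem_iInter]
      intro j hj
      have := (Submodule.mem_iInf _).1 hv ⟨j, hj⟩
      simpa [H, Projectivization.submodule_mk, Submodule.span_singleton_le_iff_mem] using this
    have := h hp
    simpa [H, Projectivization.submodule_mk, Submodule.span_singleton_le_iff_mem] using this
  have hspan := mem_span_of_iInf_ker_le_ker (L := fun j : P => A.form (i j)) hker
  by_contra ha
  refine hi.notMem_span_image ha ?_
  rwa [Set.image_eq_range]

/-- The permutation through which a flag is well fitted is unique. -/
theorem isWellFittedVia_unique {F : A.Flag} {i : Fin n → Fin l}
    (hi : LinearIndependent ℂ fun k => A.form (i k)) {σ τ : Equiv.Perm (Fin n)}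
    (hσ : F.IsWellFittedVia i σ) (hτ : F.IsWellFittedVia i τ) : σ = τ := by
  have key : ∀ {σ τ : Equiv.Perm (Fin n)}, F.IsWellFittedVia i σ → F.IsWellFittedVia i τ →
      ∀ k, k ≤ τ.symm (σ k) := by
    intro σ τ hσ hτ k
    refine mem_of_iInter_subset (A := A) (i := fun j => i (τ j)) (P := {j | k ≤ j})
      (hi.comp τ τ.injective) ?_
    have h1 : (⋂ j ∈ {j | k ≤ j}, A.H (i (τ j))) = F.S k := (hτ k).symm
    rw [h1, hσ k, Equiv.apply_symm_apply]
    exact Set.iInter₂_subset k le_rfl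
  ext1 k
  have h1 := key hσ hτ k
  have h2 := key hτ hσ (τ.symm (σ k))
  rw [Equiv.apply_symm_apply, Equiv.symm_apply_apply] at h2
  rw [← Equiv.symm_apply_eq]
  exact le_antisymm h2 h1

theorem relSign_eq {F : A.Flag} {i : Fin n → Fin l}
    (hi : LinearIndependent ℂ fun k => A.form (i k)) {σ : Equiv.Perm (Fin n)}
    (hσ : F.IsWellFittedVia i σ) : F.relSign i = Equiv.Perm.sign σ := by
  have h : F.IsWellFitted i := ⟨σ, hσ⟩
  rw [relSign, dif_pos h, isWellFittedVia_unique hi h.choose_spec hσ]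

end Flag

open Classical in
/-- The set `Desc(L)` of the descendent flags that are well fitted with respect to `L`. -/
noncomputable def desc (i : Fin n → Fin l) : Finset A.Flag :=
  Finset.univ.filter fun F => F.IsDescendent ∧ F.IsWellFitted i

end HyperplaneArrangement

namespace HyperplaneArrangement

variable {n l : ℕ} (A : HyperplaneArrangement n l)

/-! ### Intersections of hyperplanes and spans of forms -/

/-! Let `a` be the smallest index of a hyperplane containing the intersection of all `H_{i_r}`. If
`a` is not among the `i_r`, the boundary relation of the dependent tuple `(a, i)` rewrites `x_i` as
the alternating sum over `p` of `x_a` times the monomial with `i_p` omitted; if `a` is some `i_p`,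
the same identity holds by reordering (`monomial_eq_sum_cons_succAbove`). Applying this again to the
shorter tuples gives a signed sum over all permutations `σ`, whose terms are the monomials in the
head indices of `i ∘ σ` (`monomial_eq_sum_perm`).

Head indices are always weakly increasing, so a term either has a repeated factor and vanishes, or
is strictly increasing. The surviving `σ` correspond to the flags in `Desc(L)`, with matching signs.
For these, the chosen forms are independent and cut out the same tail intersections as `i ∘ σ`
(`tailInter_headIndex`). Hence the monomial is NBC and its indices determine the flag. -/

theorem mk_mem_H_iff {v : Fin (n + 1) → ℂ} (hv : v ≠ 0) (a : Fin l) :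
    Projectivization.mk ℂ v hv ∈ A.H a ↔ A.form a v = 0 := by
  simp [H, Projectivization.submodule_mk, Submodule.span_singleton_le_iff_mem]

/-- Turns containment into linear algebra: a form vanishing on the common kernel of finitely many
forms lies in their span. The zero vector, which gives no projective point, is harmless, so empty
intersections are covered too. -/
theorem biInter_H_subset_iff {ι : Type*} [Finite ι] (i : ι → Fin l) (P : Set ι) (a : Fin l) :
    (⋂ j, ⋂ _ : j ∈ P, A.H (i j)) ⊆ A.H a ↔
      A.form a ∈ Submodule.span ℂ ((fun j => A.form (i j)) '' P) := by
  constructor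
  · intro h
    rw [Set.image_eq_range]
    refine mem_span_of_iInf_ker_le_ker (L := fun j : P => A.form (i j)) fun v hv => ?_
    by_cases hv0 : v = 0
    · simp [hv0]
    refine (A.mk_mem_H_iff hv0 a).1 (h (Set.mem_iInter₂.2 fun j hj => ?_))
    exact (A.mk_mem_H_iff hv0 _).2 ((Submodule.mem_iInf _).1 hv ⟨j, hj⟩)
  · intro h p hp
    induction p with
    | h v hv =>
      rw [mk_mem_H_iff]
      have hle : Submodule.span ℂ ((fun j => A.form (i j)) '' P) ≤
          LinearMap.ker (LinearMap.applyₗ (R := ℂ) (M₂ := ℂ) v) := by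
        rw [Submodule.span_le]
        rintro _ ⟨j, hj, rfl⟩
        exact (A.mk_mem_H_iff hv _).1 (Set.mem_iInter₂.1 hp j hj)
      exact hle h

/-- At most `n` linear equations in `n + 1` unknowns have a nonzero solution. -/
theorem iInter_H_nonempty {m : ℕ} (hm : m ≤ n) (i : Fin m → Fin l) :
    (⋂ k, A.H (i k)).Nonempty := by
  have hker : LinearMap.ker (LinearMap.pi fun k => A.form (i k)) ≠ ⊥ :=
    LinearMap.ker_ne_bot_of_finrank_lt (by simpa using Nat.lt_succ_of_le hm)
  obtain ⟨v, hv, hv0⟩ := Submodule.exists_mem_ne_zero_of_ne_bot hker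
  refine ⟨Projectivization.mk ℂ v hv0, Set.mem_iInter.2 fun k => ?_⟩
  exact (A.mk_mem_H_iff hv0 _).2 (congrFun hv k)

/-! ### The smallest hyperplanes containing the final intersections of a tuple -/

/-- The intersection `⋂_{r ≥ k} H_{i_r}`. -/
def tailInter {m : ℕ} (i : Fin m → Fin l) (k : Fin m) :
    Set (Projectivization ℂ (Fin (n + 1) → ℂ)) :=
  ⋂ r, ⋂ _ : k ≤ r, A.H (i r)

variable {A}

theorem tailInter_subset_iff {m : ℕ} {i : Fin m → Fin l} {k : Fin m} {a : Fin l} :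
    A.tailInter i k ⊆ A.H a ↔
      A.form a ∈ Submodule.span ℂ ((fun j => A.form (i j)) '' Set.Ici k) :=
  A.biInter_H_subset_iff i (Set.Ici k) a

theorem tailInter_subset_self {m : ℕ} (i : Fin m → Fin l) (k : Fin m) :
    A.tailInter i k ⊆ A.H (i k) :=
  Set.iInter₂_subset k le_rfl

theorem tailInter_mono {m : ℕ} (i : Fin m → Fin l) : Monotone (A.tailInter i) :=
  fun _ _ h => Set.iInter_mono fun _ => Set.iInter_mono' fun hk => ⟨h.trans hk, le_rfl⟩

theorem tailInter_succ {m : ℕ} (i : Fin (m + 1) → Fin l) (k : Fin m) :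
    A.tailInter i k.succ = A.tailInter (fun r => i r.succ) k := by
  ext p
  simp only [tailInter, Set.mem_iInter]
  refine ⟨fun h r hr => h _ (Fin.succ_le_succ_iff.2 hr), fun h r => ?_⟩
  cases r using Fin.cases with
  | zero => exact fun hr => absurd hr (by simp)
  | succ r => exact fun hr => h r (Fin.succ_le_succ_iff.1 hr)

theorem tailInter_zero {m : ℕ} (i : Fin (m + 1) → Fin l) :
    A.tailInter i 0 = ⋂ r, A.H (i r) := by
  simp [tailInter]

theorem tailInter_zero_comp_perm {m : ℕ} (i : Fin (m + 1) → Fin l)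
    (σ : Equiv.Perm (Fin (m + 1))) :
    A.tailInter (fun r => i (σ r)) 0 = A.tailInter i 0 := by
  rw [tailInter_zero, tailInter_zero]
  exact σ.surjective.iInter_comp fun r => A.H (i r)

theorem tailInter_strictMono {i : Fin n → Fin l}
    (hi : LinearIndependent ℂ fun k => A.form (i k)) : StrictMono (A.tailInter i) := by
  intro j k hjk
  refine (tailInter_mono i hjk.le).lt_of_ne fun h => ?_
  have : (⋂ r ∈ Set.Ici k, A.H (i r)) ⊆ A.H (i j) := h.symm.subset.trans (tailInter_subset_self i j)
  exact hjk.not_ge (Flag.mem_of_iInter_subset hi this)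

variable (A) in
open Classical in
/-- The smallest index of a hyperplane containing `⋂_{r ≥ k} H_{i_r}`. -/
noncomputable def headIndex {m : ℕ} (i : Fin m → Fin l) (k : Fin m) : Fin l :=
  (Finset.univ.filter fun j : Fin l => A.tailInter i k ⊆ A.H j).min'
    ⟨i k, by simpa using tailInter_subset_self i k⟩

theorem tailInter_subset_headIndex {m : ℕ} (i : Fin m → Fin l) (k : Fin m) :
    A.tailInter i k ⊆ A.H (A.headIndex i k) := by
  classical
  exact (Finset.mem_filter.1 (Finset.min'_mem (Finset.univ.filter fun j : Fin l =>
    A.tailInter i k ⊆ A.H j) ⟨i k, by simpa using tailInter_subset_self i k⟩)).2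

theorem headIndex_le {m : ℕ} {i : Fin m → Fin l} {k : Fin m} {a : Fin l}
    (h : A.tailInter i k ⊆ A.H a) : A.headIndex i k ≤ a :=
  Finset.min'_le _ _ (by simpa using h)

theorem headIndex_congr {m m' : ℕ} {i : Fin m → Fin l} {i' : Fin m' → Fin l} {k : Fin m}
    {k' : Fin m'} (h : A.tailInter i k = A.tailInter i' k') :
    A.headIndex i k = A.headIndex i' k' :=
  le_antisymm (headIndex_le (h ▸ tailInter_subset_headIndex i' k'))
    (headIndex_le (h ▸ tailInter_subset_headIndex i k))

theorem headIndex_monotone {m : ℕ} (i : Fin m → Fin l) : Monotone (A.headIndex i) :=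
  fun _ k h => headIndex_le ((tailInter_mono i h).trans (tailInter_subset_headIndex i k))

theorem tailInter_subset_tailInter_headIndex {m : ℕ} (i : Fin m → Fin l) (k : Fin m) :
    A.tailInter i k ⊆ A.tailInter (A.headIndex i) k :=
  Set.subset_iInter₂ fun r hr => (tailInter_mono i hr).trans (tailInter_subset_headIndex i r)

/-- If the first form were in the span of the later ones, its hyperplane would contain the next tail
intersection, so the next head index could not be larger. -/
theorem linearIndependent_headIndex {m : ℕ} {i : Fin m → Fin l}
    (h : StrictMono (A.headIndex i)) :
    LinearIndependent ℂ fun k => A.form (A.headIndex i k) := by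
  induction m with
  | zero => exact linearIndependent_empty_type
  | succ m ih =>
    have htail : ∀ k : Fin m, A.headIndex i k.succ = A.headIndex (fun r => i r.succ) k :=
      fun k => headIndex_congr (tailInter_succ i k)
    refine linearIndependent_finSucc.2 ⟨?_, fun hmem => ?_⟩
    · have := ih (i := fun r => i r.succ) fun j k hjk => by
        rw [← htail, ← htail]
        exact h (Fin.succ_lt_succ_iff.2 hjk)
      simpa only [Fin.tail_def, htail] using this
    · cases m with
      -- With no later forms the span is zero, so the single form would vanish.
      | zero =>
        refine A.form_ne_zero (A.headIndex i 0) ?_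
        simpa [Set.range_eq_empty] using hmem
      | succ m =>
        have hsub : A.tailInter i 1 ⊆ A.H (A.headIndex i 0) := by
          refine (tailInter_subset_tailInter_headIndex i 1).trans (tailInter_subset_iff.2 ?_)
          refine Submodule.span_mono ?_ hmem
          rintro _ ⟨k, rfl⟩
          exact ⟨k.succ, by simp [Fin.le_def], rfl⟩
        exact (h (Fin.zero_lt_one)).not_ge (headIndex_le hsub)

/-- The head forms from position `k` on lie in the span of the original ones from `k` on. Both
families are independent of the same size, so the spans agree. -/
theorem tailInter_headIndex {m : ℕ} {i : Fin m → Fin l}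
    (hi : LinearIndependent ℂ fun k => A.form (i k)) (h : StrictMono (A.headIndex i))
    (k : Fin m) : A.tailInter (A.headIndex i) k = A.tailInter i k := by
  refine (Set.subset_iInter₂ fun r hr => ?_).antisymm (tailInter_subset_tailInter_headIndex i k)
  rw [tailInter_subset_iff]
  have hle : Submodule.span ℂ ((fun j => A.form (A.headIndex i j)) '' Set.Ici k) ≤
      Submodule.span ℂ ((fun j => A.form (i j)) '' Set.Ici k) := by
    rw [Submodule.span_le]
    rintro _ ⟨s, hs, rfl⟩
    exact tailInter_subset_iff.1 ((tailInter_mono i hs).trans (tailInter_subset_headIndex i s))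
  have heq := Submodule.eq_of_le_of_finrank_eq hle (by
    rw [Set.image_eq_range, Set.image_eq_range]
    exact (finrank_span_eq_card
      ((linearIndependent_headIndex h).comp _ Subtype.val_injective)).trans
        (finrank_span_eq_card (hi.comp _ Subtype.val_injective)).symm)
  rw [heq]
  exact Submodule.subset_span ⟨r, hr, rfl⟩

/-! ### Monomials -/

theorem extMonomial_cons {m : ℕ} (a : Fin l) (i : Fin m → Fin l) :
    extMonomial l (Fin.cons a i : Fin (m + 1) → Fin l) =
      ExteriorAlgebra.ι ℂ (Pi.single a 1 : Fin l → ℂ) * extMonomial l i :=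
  ExteriorAlgebra.ιMulti_succ_apply _

theorem extMonomial_eq_zero {m : ℕ} {i : Fin m → Fin l} (h : ¬ Function.Injective i) :
    extMonomial l i = 0 :=
  AlternatingMap.map_eq_zero_of_not_injective _ _ fun h' =>
    h (Function.Injective.of_comp (f := fun a => (Pi.single a 1 : Fin l → ℂ)) h')

theorem extMonomial_comp_perm {m : ℕ} (i : Fin m → Fin l) (σ : Equiv.Perm (Fin m)) :
    extMonomial l (fun k => i (σ k)) = (Equiv.Perm.sign σ : ℤ) • extMonomial l i :=
  AlternatingMap.map_perm (ExteriorAlgebra.ιMulti ℂ m)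
    (fun k => (Pi.single (i k) 1 : Fin l → ℂ)) σ

theorem monomial_cons {m : ℕ} (a : Fin l) (i : Fin m → Fin l) :
    A.monomial (Fin.cons a i : Fin (m + 1) → Fin l) =
      A.osIdeal.ringCon.mk' (ExteriorAlgebra.ι ℂ (Pi.single a 1 : Fin l → ℂ)) * A.monomial i := by
  rw [monomial, extMonomial_cons, map_mul, monomial]

theorem monomial_eq_zero {m : ℕ} {i : Fin m → Fin l} (h : ¬ Function.Injective i) :
    A.monomial i = 0 := by
  rw [monomial, extMonomial_eq_zero h, map_zero]

theorem mk'_eq_zero_of_isOSRelation {x : ExteriorAlgebra ℂ (Fin l → ℂ)}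
    (hx : A.IsOSRelation x) : A.osIdeal.ringCon.mk' x = 0 := by
  rw [← TwoSidedIdeal.mem_ker, TwoSidedIdeal.ker_ringCon_mk']
  exact TwoSidedIdeal.subset_span hx

theorem monomial_eq_sum_cons_succAbove {m : ℕ} (i : Fin (m + 1) → Fin l)
    (hi : Function.Injective i) {a : Fin l} (ha : A.tailInter i 0 ⊆ A.H a) :
    A.monomial i = ∑ p : Fin (m + 1),
      (-1 : ℤ) ^ (p : ℕ) • A.monomial (Fin.cons a fun k => i (p.succAbove k)) := by
  by_cases har : ∃ q, i q = a
  · obtain ⟨q, rfl⟩ := har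
    rw [Finset.sum_eq_single q]
    -- Moving `i q` to the front is a cycle of sign `(-1)^q`, which cancels the coefficient.
    · have hcons : (Fin.cons (i q) fun k => i (q.succAbove k) : Fin (m + 1) → Fin l) =
          fun k => i (q.cycleRange.symm k) := by
        ext k
        cases k using Fin.cases with
        | zero => simp
        | succ k => simp
      rw [hcons, monomial, monomial, extMonomial_comp_perm, map_zsmul, smul_smul,
        Equiv.Perm.sign_symm, Fin.sign_cycleRange]
      simp [← mul_pow]
    -- Omitting another position leaves `i q` in the tuple, so it occurs twice.
    · intro p _ hp
      rw [monomial_eq_zero, smul_zero]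
      intro hinj
      obtain ⟨k, hk⟩ := Fin.exists_succAbove_eq hp.symm
      exact Fin.succ_ne_zero k (hinj (by simp [hk]))
    · simp
  · have hrel : A.IsOSRelation (extBoundary l (Fin.cons a i : Fin (m + 2) → Fin l)) := by
      refine .boundary _ (Fin.cons_injective_iff.2 ⟨fun ⟨q, hq⟩ => har ⟨q, hq⟩, hi⟩) fun h => ?_
      refine (linearIndependent_finSucc.1 h).2 ?_
      have := tailInter_subset_iff.1 ha
      refine Submodule.span_mono ?_ this
      rintro _ ⟨k, -, rfl⟩
      exact ⟨k, rfl⟩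
    have h0 := A.mk'_eq_zero_of_isOSRelation hrel
    have htail : ∀ p : Fin (m + 1), (fun k => (Fin.cons a i : Fin (m + 2) → Fin l)
        (p.succ.succAbove k)) = Fin.cons a fun k => i (p.succAbove k) := by
      intro p
      ext k
      cases k using Fin.cases with
      | zero => simp
      | succ k => simp
    -- Position `0` contributes `-x_i`; position `p + 1` has sign `(-1)^(p + 2) = (-1)^p`.
    rw [extBoundary, Fin.sum_univ_succ, map_add, map_sum] at h0
    simp only [htail, map_zsmul] at h0
    simp only [Fin.succAbove_zero, Fin.cons_succ, Fin.val_zero, zero_add, neg_smul, pow_zero,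
      one_smul, Fin.val_succ, pow_succ, mul_neg, mul_one, neg_neg] at h0
    exact neg_add_eq_zero.1 h0

/-! ### Expansion over permutations -/

/-- The permutation of `Fin (m + 1)` that maps `0` to `p` and `k + 1` to `p.succAbove (e k)`. -/
def permSuccAbove {m : ℕ} (x : Fin (m + 1) × Equiv.Perm (Fin m)) : Equiv.Perm (Fin (m + 1)) :=
  x.1.cycleRange.symm * Equiv.Perm.decomposeFin.symm (0, x.2)

@[simp]
theorem permSuccAbove_zero {m : ℕ} (x : Fin (m + 1) × Equiv.Perm (Fin m)) :
    permSuccAbove x 0 = x.1 := by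
  simp [permSuccAbove]

@[simp]
theorem permSuccAbove_succ {m : ℕ} (x : Fin (m + 1) × Equiv.Perm (Fin m)) (k : Fin m) :
    permSuccAbove x k.succ = x.1.succAbove (x.2 k) := by
  simp [permSuccAbove]

theorem sign_permSuccAbove {m : ℕ} (x : Fin (m + 1) × Equiv.Perm (Fin m)) :
    (Equiv.Perm.sign (permSuccAbove x) : ℤ) = (-1) ^ (x.1 : ℕ) * Equiv.Perm.sign x.2 := by
  simp [permSuccAbove, Equiv.Perm.decomposeFin.symm_sign, Fin.sign_cycleRange]

theorem permSuccAbove_bijective {m : ℕ} :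
    Function.Bijective (permSuccAbove (m := m)) := by
  rw [Fintype.bijective_iff_injective_and_card]
  refine ⟨fun ⟨p, e⟩ ⟨q, f⟩ h => ?_, by simp [Fintype.card_perm, Nat.factorial_succ]⟩
  obtain rfl : p = q := by simpa using Equiv.congr_fun h 0
  refine Prod.ext rfl (Equiv.ext fun k => ?_)
  simpa using Equiv.congr_fun h k.succ

/-- Induction on the length: choosing the omitted position `p` and then a permutation of the rest
amounts to choosing a permutation with `σ 0 = p`. -/
theorem monomial_eq_sum_perm {m : ℕ} (i : Fin m → Fin l)
    (hi : LinearIndependent ℂ fun k => A.form (i k)) :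
    A.monomial i = ∑ σ : Equiv.Perm (Fin m),
      (Equiv.Perm.sign σ : ℤ) • A.monomial (A.headIndex fun k => i (σ k)) := by
  induction m with
  | zero =>
    rw [Fintype.sum_unique]
    simp only [Equiv.Perm.default_eq, Equiv.Perm.sign_one, Units.val_one, one_smul]
    exact congrArg A.monomial (Subsingleton.elim _ _)
  | succ m ih =>
    have hinj : Function.Injective i := fun j k h => hi.injective (congrArg A.form h)
    have hhead : ∀ (p : Fin (m + 1)) (e : Equiv.Perm (Fin m)),
        A.headIndex (fun k => i (permSuccAbove (p, e) k)) =
          Fin.cons (A.headIndex i 0) (A.headIndex fun k => i (p.succAbove (e k))) := by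
      intro p e
      funext k
      cases k using Fin.cases with
      -- The full intersection ignores the order, so all permutations share the first head index.
      | zero => exact headIndex_congr (tailInter_zero_comp_perm i _)
      | succ k =>
        refine headIndex_congr ((tailInter_succ _ k).trans ?_)
        simp only [permSuccAbove_succ]
    rw [monomial_eq_sum_cons_succAbove i hinj (tailInter_subset_headIndex i 0),
      ← permSuccAbove_bijective.sum_comp, Fintype.sum_prod_type]
    refine Finset.sum_congr rfl fun p _ => ?_
    rw [monomial_cons, ih (fun k => i (p.succAbove k))
      (hi.comp _ Fin.succAbove_right_injective), Finset.mul_sum, Finset.smul_sum]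
    refine Finset.sum_congr rfl fun e _ => ?_
    rw [hhead, monomial_cons, sign_permSuccAbove, mul_smul, mul_smul_comm]

/-! ### Flags of permutations -/

/-- The flag `S_k = ⋂_{r ≥ k} H_{i_r}` of an independent tuple. -/
def tailFlag (i : Fin n → Fin l) (hi : LinearIndependent ℂ fun k => A.form (i k)) : A.Flag where
  S := A.tailInter i
  exists_eq k := ⟨(Finset.Ici k).image i, ⟨i k, Finset.mem_image_of_mem i (by simp)⟩, by
    ext p
    simp [tailInter]⟩
  nonempty _ := (A.iInter_H_nonempty le_rfl i).mono
    (Set.subset_iInter₂ fun r _ => Set.iInter_subset _ r)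
  strictMono := tailInter_strictMono hi

namespace Flag

theorem index_le {F : A.Flag} {k : Fin n} {a : Fin l} (h : F.S k ⊆ A.H a) : F.index k ≤ a :=
  Finset.min'_le _ _ (by simpa using h)

theorem S_subset_index (F : A.Flag) (k : Fin n) : F.S k ⊆ A.H (F.index k) := by
  classical
  exact (Finset.mem_filter.1 (Finset.min'_mem (Finset.univ.filter fun j : Fin l =>
    F.S k ⊆ A.H j) (F.index_nonempty k))).2

theorem IsWellFittedVia.index_eq {F : A.Flag} {i : Fin n → Fin l} {σ : Equiv.Perm (Fin n)}
    (h : F.IsWellFittedVia i σ) : F.index = A.headIndex fun k => i (σ k) := by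
  funext k
  have hk : F.S k = A.tailInter (fun k => i (σ k)) k := h k
  exact le_antisymm (index_le (hk ▸ tailInter_subset_headIndex _ k))
    (headIndex_le (hk ▸ F.S_subset_index k))

/-- A descendent well fitted flag is recovered from its indices; this yields both minimality in the
NBC condition and injectivity. -/
theorem IsWellFittedVia.S_eq_tailInter_index {F : A.Flag} {i : Fin n → Fin l}
    {σ : Equiv.Perm (Fin n)} (h : F.IsWellFittedVia i σ)
    (hi : LinearIndependent ℂ fun k => A.form (i k)) (hF : F.IsDescendent) (k : Fin n) :
    F.S k = A.tailInter F.index k := by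
  rw [IsDescendent, h.index_eq] at hF
  rw [h.index_eq, tailInter_headIndex (hi.comp σ σ.injective) hF]
  exact h k

end Flag

/-! ### The NBC expansion over `Desc(L)` -/

theorem mem_desc {i : Fin n → Fin l} {F : A.Flag} :
    F ∈ A.desc i ↔ F.IsDescendent ∧ F.IsWellFitted i := by
  simp [desc]

theorem isNBC_index_of_mem_desc {i : Fin n → Fin l}
    (hi : LinearIndependent ℂ fun k => A.form (i k)) {F : A.Flag} (hF : F ∈ A.desc i) :
    A.IsNBC F.index := by
  obtain ⟨hdesc, σ, hσ⟩ := mem_desc.1 hF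
  refine ⟨le_rfl, hdesc, ?_, fun j a h => ?_⟩
  · have hmono : StrictMono F.index := hdesc
    rw [hσ.index_eq] at hmono ⊢
    exact linearIndependent_headIndex hmono
  · exact Flag.index_le ((hσ.S_eq_tailInter_index hi hdesc j).subset.trans h)

theorem injOn_index_desc {i : Fin n → Fin l}
    (hi : LinearIndependent ℂ fun k => A.form (i k)) :
    Set.InjOn (fun F : A.Flag => F.index) (A.desc i) := by
  intro F hF G hG h
  obtain ⟨hFd, σ, hσ⟩ := mem_desc.1 hF
  obtain ⟨hGd, τ, hτ⟩ := mem_desc.1 hG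
  ext1
  funext k
  rw [hσ.S_eq_tailInter_index hi hFd, hτ.S_eq_tailInter_index hi hGd]
  exact congrArg (fun j => A.tailInter j k) h

theorem monomial_eq_sum_desc {i : Fin n → Fin l}
    (hi : LinearIndependent ℂ fun k => A.form (i k)) :
    A.monomial i = ∑ F ∈ A.desc i, F.relSign i • A.monomial F.index := by
  classical
  rw [monomial_eq_sum_perm i hi, ← Finset.sum_filter_of_ne
    (p := fun σ : Equiv.Perm (Fin n) => StrictMono (A.headIndex fun k => i (σ k)))]
  · have hfit : ∀ σ : Equiv.Perm (Fin n), (tailFlag (A := A) (fun k => i (σ k))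
        (hi.comp σ σ.injective)).IsWellFittedVia i σ := fun _ _ => rfl
    refine Finset.sum_bij (fun σ _ => tailFlag (fun k => i (σ k)) (hi.comp σ σ.injective))
      (fun σ hσ => ?_) (fun σ _ τ _ h => ?_) (fun F hF => ?_) fun σ _ => ?_
    · refine mem_desc.2 ⟨?_, σ, hfit σ⟩
      rw [Flag.IsDescendent, (hfit σ).index_eq]
      exact (Finset.mem_filter.1 hσ).2
    · exact Flag.isWellFittedVia_unique hi (hfit σ) (h ▸ hfit τ)
    · obtain ⟨hdesc, σ, hσ⟩ := mem_desc.1 hF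
      rw [Flag.IsDescendent, hσ.index_eq] at hdesc
      exact ⟨σ, by simpa using hdesc, Flag.ext (funext fun k => (hσ k).symm)⟩
    · rw [Flag.relSign_eq hi (hfit σ), (hfit σ).index_eq]
  -- A monotone tuple that is not strictly monotone repeats an index, so its monomial is zero.
  · intro σ _ hσ
    by_contra hmono
    refine hσ ?_
    rw [monomial_eq_zero fun hinj => hmono ((headIndex_monotone _).strictMono_of_injective hinj),
      smul_zero]

end HyperplaneArrangement

theorem mainTheorem4 {n l : ℕ} (A : HyperplaneArrangement n l) (i : Fin n → Fin l)
    (hi : LinearIndependent ℂ fun k => A.form (i k)) :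
    (∀ F ∈ A.desc i, A.IsNBC F.index) ∧
    Set.InjOn (fun F : A.Flag => F.index) (A.desc i) ∧
    A.monomial i = ∑ F ∈ A.desc i, F.relSign i • A.monomial F.index :=
  ⟨fun _ hF => HyperplaneArrangement.isNBC_index_of_mem_desc hi hF,
    HyperplaneArrangement.injOn_index_desc hi, HyperplaneArrangement.monomial_eq_sum_desc hi⟩
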